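/- Distributions over $\{0,1\}^N$ are compared by the earth mover distance $d_{EM}$ with respect to the normalized Hamming distance. A distribution property is a closed set $\mathcal P$ of distributions over $\{0,1\}^N$. A distribution $D$ is $\varepsilon$-far from $\mathcal P$ if its distance $\min_{D'\in\mathcal P}d_{EM}(D,D')$ from $\mathcal P$ is more than $\varepsilon$; every $D$ is $\varepsilon$-far from the empty property. $\mathcal P$ is index-invariant if it is preserved, in both directions, by every permutation of the $N$ coordinates. A randomized algorithm that draws $s$ independent samples from an unknown distribution $D$ and queries single coordinates (bits) of the samples $\varepsilon$-tests $\mathcal P$ if it accepts with probability at least $2/3$ when $D\in\mathcal P$ and rejects with probability at least $2/3$ when $D$ is $\varepsilon$-far from $\mathcal P$. An adaptive algorithm may choose each query depending on its coins and on the earlier answers; a non-adaptive algorithm fixes all queries from its coins alone. Only queries are bounded; the numbers of samples and the running times are not. For $n\ge 0$ let $\mathcal P_{Pal}$ be the set of words $S=XY$ of length $n$ over $\{0,1,2,3\}$, where $X$ is a (possibly empty) palindrome over $\{0,1\}$ and $Y$ is a (possibly empty) palindrome over $\{2,3\}$. View it as a set of strings in $\{0,1\}^{2n}$ by writing each letter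 in binary with two bits. Let $1_{\mathcal P_{Pal}}$ be the property of all distributions over $\{0,1\}^{2n}$ whose support is a single string and whose string belongs to $\mathcal P_{Pal}$. **Proposition 6.5.** 1. For every $n\ge 2$, $1_{\mathcal P_{Pal}}$ is not index-invariant. 2. For every $\varepsilon\in(0,1)$ there is a constant $C>0$ such that for every $n\ge2$ some adaptive algorithm $\varepsilon$-tests $1_{\mathcal P_{Pal}}$ with at most $C\log n$ queries. 3. There are $\varepsilon\in(0,1)$, $c>0$ and $n_0$ such that for every $n\ge n_0$ every non-adaptive algorithm that $\varepsilon$-tests $1_{\mathcal P_{Pal}}$, with any number of samples, has query complexity at least $c\sqrt n$. 4. Conversely, an exponential gap is the largest possible: for every $N\ge 0$, every distribution property $\mathcal P$ over $\{0,1\}^N$, every $\varepsilon\in(0,1)$ and all integers $s,q\ge0$, if some adaptive algorithm with $s$ samples and at most $q$ queries $\varepsilon$-tests $\mathcal P$, then some non-adaptive algorithm with $s$ samples and at most $2^q-1$ queries $\varepsilon$-tests $\mathcal P$. -/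

import Mathlib

namespace HugeObject

/-- The Hamming cube `{0,1}^n`. -/
abbrev Cube (n : ℕ) : Type := Fin n → Bool

/-- Probability distributions over the Hamming cube `{0,1}^n`, with the topology of `ℝ^({0,1}^n)`. -/
abbrev Dist (n : ℕ) : Type := stdSimplex ℝ (Cube n)

/-- Normalized Hamming distance. -/
noncomputable def normHamming {n : ℕ} (X Y : Cube n) : ℝ := (hammingDist X Y : ℝ) / n

/-- Feasible solutions of the linear program that defines the earth mover distance. -/
structure IsTransport {n : ℕ} (D₁ D₂ : Dist n) (f : Cube n → Cube n → ℝ) : Prop where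
  nonneg : ∀ X Y, 0 ≤ f X Y
  le_one : ∀ X Y, f X Y ≤ 1
  row : ∀ X, ∑ Y, f X Y = D₁.1 X
  col : ∀ Y, ∑ X, f X Y = D₂.1 Y

/-- Earth mover distance. The program is feasible (take `f X Y = D₁ X * D₂ Y`) and its objective is
nonnegative, so the infimum of reals is meaningful. -/
noncomputable def emd {n : ℕ} (D₁ D₂ : Dist n) : ℝ :=
  sInf {c : ℝ | ∃ f, IsTransport D₁ D₂ f ∧ c = ∑ X, ∑ Y, f X Y * normHamming X Y}

/-- A distribution property over `{0,1}^n`: a topologically closed set of distributions. -/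
abbrev DistProperty (n : ℕ) : Type := TopologicalSpace.Closeds (Dist n)

/-- `D` is `ε`-far from `P`: the distance of `D` from `P`, that is the minimum of `emd D D'` over
`D' ∈ P`, is more than `ε`. (The minimum is attained, because `P` is closed in a compact space; all
distributions are far from the empty property.) -/
def IsFar {n : ℕ} (ε : ℝ) (D : Dist n) (P : DistProperty n) : Prop :=
  ∀ D' ∈ P, ε < emd D D'

/-- The distribution `D_σ`, with `D_σ (w ∘ σ) = D w` for all `w`. -/
noncomputable def permute {n : ℕ} (σ : Equiv.Perm (Fin n)) (D : Dist n) : Dist n :=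
  ⟨fun w => D.1 (w ∘ σ.symm), fun w => D.2.1 (w ∘ σ.symm),
    (Equiv.sum_comp (σ.arrowCongr (Equiv.refl Bool)) D.1).trans D.2.2⟩

/-- Index-invariant distribution properties. -/
def IndexInvariant {n : ℕ} (P : DistProperty n) : Prop :=
  ∀ (D : Dist n) (σ : Equiv.Perm (Fin n)), D ∈ P ↔ permute σ D ∈ P

/-! ### Testers -/

/-- The probability that a randomized procedure outputs `b`, when its coins are drawn from `law` and
it is run on `s` vectors drawn independently from `D`. -/
noncomputable def outputProb {n s : ℕ} {Coins : Type} (law : PMF Coins)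
    (run : Coins → (Fin s → Cube n) → Bool) (D : Dist n) (b : Bool) : ℝ :=
  ∑' ω, (law ω).toReal *
    ∑ V : Fin s → Cube n, (∏ i, D.1 (V i)) * (if run ω V = b then 1 else 0)

/-- The procedure `ε`-tests `P` (success probability `2/3`); the output `true` means "accept". -/
def Tests {n s : ℕ} {Coins : Type} (law : PMF Coins)
    (run : Coins → (Fin s → Cube n) → Bool) (ε : ℝ) (P : DistProperty n) : Prop :=
  (∀ D ∈ P, 2 / 3 ≤ outputProb law run D true) ∧
    ∀ D, IsFar ε D P → 2 / 3 ≤ outputProb law run D false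

/-- Deterministic adaptive query strategies on `s` vectors of length `n`: either stop with an answer,
or query coordinate `j` of vector `i` and continue according to the bit received. -/
inductive QueryTree (s n : ℕ) : Type
  | leaf (answer : Bool) : QueryTree s n
  | query (i : Fin s) (j : Fin n) (next : Bool → QueryTree s n) : QueryTree s n

/-- The number of queries made in the worst case. -/
def QueryTree.depth {s n : ℕ} : QueryTree s n → ℕ
  | .leaf _ => 0
  | .query _ _ next => max (next false).depth (next true).depth + 1

/-- The answer of the strategy on the sampled vectors `V`. -/
def QueryTree.run {s n : ℕ} : QueryTree s n → (Fin s → Cube n) → Bool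
  | .leaf answer, _ => answer
  | .query i j next, V => (next (V i j)).run V

/-- Randomized adaptive algorithms with `s` samples and at most `q` queries: each query depends on
the coins and on the answers to the earlier queries, the output on the coins and on all answers.
As there are finitely many strategies up to equivalence, discrete coins are fully general. -/
structure AdaptiveAlg (n s q : ℕ) where
  Coins : Type
  law : PMF Coins
  tree : Coins → QueryTree s n
  depth_le : ∀ ω, (tree ω).depth ≤ q

/-- Randomized non-adaptive algorithms with `s` samples and at most `q` queries: the sets `J ω i`
of queried coordinates are fixed by the coins `ω`, and the output depends on `ω` and on the
restrictions of the sampled vectors to these sets. -/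
structure NonadaptiveAlg (n s q : ℕ) where
  Coins : Type
  law : PMF Coins
  J : Coins → Fin s → Finset (Fin n)
  card_le : ∀ ω, ∑ i, (J ω i).card ≤ q
  output : (ω : Coins) → ((i : Fin s) → (j : Fin n) → j ∈ J ω i → Bool) → Bool

/-- Some adaptive algorithm with `s` samples and at most `q` queries `ε`-tests `P`. -/
def AdaptivelyTestable {n : ℕ} (P : DistProperty n) (ε : ℝ) (s q : ℕ) : Prop :=
  ∃ A : AdaptiveAlg n s q, Tests A.law (fun ω V => (A.tree ω).run V) ε P

/-- Some non-adaptive algorithm with `s` samples and at most `q` queries `ε`-tests `P`. -/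
def NonadaptivelyTestable {n : ℕ} (P : DistProperty n) (ε : ℝ) (s q : ℕ) : Prop :=
  ∃ A : NonadaptiveAlg n s q, Tests A.law (fun ω V => A.output ω fun i j _ => V i j) ε P

/-! ### The property `1_{P_Pal}` -/

theorem finite_singleton_support {n : ℕ} (P : Set (Cube n)) :
    {D : Dist n | ∃ X ∈ P, Function.support D.1 = {X}}.Finite := by
  refine Set.Finite.of_injOn (f := fun D : Dist n => Function.support D.1)
    (t := Set.univ) (fun _ _ => Set.mem_univ _) ?_ Set.finite_univ
  have key : ∀ (D : Dist n) (X : Cube n), Function.support D.1 = {X} →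
      D.1 = fun Y => if Y = X then 1 else 0 := by
    intro D X h
    have h0 : ∀ Y, Y ≠ X → D.1 Y = 0 := fun Y hY => by
      by_contra hne
      have : Y ∈ Function.support D.1 := hne
      rw [h] at this
      exact hY this
    have h1 : D.1 X = 1 := by
      rw [← D.2.2]
      exact (Finset.sum_eq_single X (fun Y _ hY => h0 Y hY) (by simp)).symm
    funext Y
    by_cases hY : Y = X
    · simp [hY, h1]
    · simp [hY, h0 Y hY]
  rintro D ⟨X, -, hX⟩ D' - hDD'
  have hX' : Function.support D'.1 = {X} := by
    rw [← hX]
    exact hDD'.symm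
  exact Subtype.ext ((key D X hX).trans (key D' X hX').symm)

/-- The distribution property `1_P` of a string property `P`: the support of the distribution has
size one, and the single string in it satisfies `P`. -/
def onePoint {n : ℕ} (P : Set (Cube n)) : DistProperty n where
  carrier := {D : Dist n | ∃ X ∈ P, Function.support D.1 = {X}}
  isClosed' := (finite_singleton_support P).isClosed

/-- Words over `{0,1,2,3}` that are a (possibly empty) palindrome over `{0,1}` followed by a
(possibly empty) palindrome over `{2,3}`. -/
def IsPal (S : List (Fin 4)) : Prop :=
  ∃ X Y : List (Fin 4), S = X ++ Y ∧
    X.Palindrome ∧ (∀ a ∈ X, a = 0 ∨ a = 1) ∧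
    Y.Palindrome ∧ (∀ a ∈ Y, a = 2 ∨ a = 3)

/-- The letter encoded by two bits, in binary. -/
def letter : Bool → Bool → Fin 4
  | false, false => 0
  | false, true => 1
  | true, false => 2
  | true, true => 3

/-- The word of length `n` over `{0,1,2,3}` encoded by a bit string of length `2n`: the letter at
position `i` is encoded by the bits at positions `2i` and `2i+1` (counted from zero). -/
def decode {n : ℕ} (w : Cube (2 * n)) : List (Fin 4) :=
  List.ofFn fun i : Fin n => letter (w ⟨2 * i.1, by omega⟩) (w ⟨2 * i.1 + 1, by omega⟩)

/-- The property `1_{P_Pal}` for words of length `n`, a property of distributions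
over `{0,1}^(2n)`. -/
def onePal (n : ℕ) : DistProperty (2 * n) :=
  onePoint {w : Cube (2 * n) | IsPal (decode w)}

end HugeObject

/-! A word has the property exactly when its high bits jump once, at some threshold `k`, and its low
bits are invariant under `mirror k`, which reflects each of the two blocks (`isPal_decode_iff`).
Swapping two high bits can destroy the jump, so index-invariance fails.

Adaptively, binary search in the high bits of the first sample `X` yields a threshold, and
symmetrizing the low bits of `X` gives a word `g X` of the property, of which any bit costs one
further query. A constant number of fresh samples is compared with `g X`, each at a random
coordinate. The earth mover distance to a point mass is at most the expected Hamming distance, so if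
`D` is far, each comparison fails with probability above `ε`, whatever `X` was
(`adaptivelyTestable_onePal`).

Non-adaptive queries have to be chosen without knowing `k`. For uniform `k`, a fixed set of `q`
letters contains a mirrored pair for at most `q ^ 2` of the `n` thresholds (`card_collisions_le`).
For the other thresholds, a uniform low-bit string and its symmetrization look alike on the queried
letters (`sum_symmetrize`). The symmetrized word is in the property, whereas a uniform string is
usually far from every symmetric one (`eventually_card_nearSymmetric_le`); hence `q ^ 2` is at least
of order `n`.

For the exponential simulation, all nodes of the decision tree are queried at once. -/

open Finset
namespace HugeObject

/-! ### Distributions concentrated on one string -/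

/-- The distribution supported on the single string `w`. -/
noncomputable def pointDist {n : ℕ} (w : Cube n) : Dist n :=
  ⟨Pi.single w 1, single_mem_stdSimplex ℝ w⟩

theorem pointDist_apply {n : ℕ} (w X : Cube n) :
    (pointDist w).1 X = if X = w then 1 else 0 := by
  simp [pointDist, Pi.single_apply]

theorem support_pointDist {n : ℕ} (w : Cube n) : Function.support (pointDist w).1 = {w} := by
  ext X
  simp [pointDist_apply]

theorem eq_pointDist {n : ℕ} {D : Dist n} {w : Cube n} (h : Function.support D.1 = {w}) :
    D = pointDist w := by
  have h0 : ∀ Y, Y ≠ w → D.1 Y = 0 := fun Y hY => by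
    by_contra hne
    have : Y ∈ Function.support D.1 := hne
    rw [h] at this
    exact hY this
  have h1 : D.1 w = 1 := by
    rw [← D.2.2]
    exact (Finset.sum_eq_single w (fun Y _ hY => h0 Y hY) (by simp)).symm
  refine Subtype.ext (funext fun Y => ?_)
  rw [pointDist_apply]
  split_ifs with hY
  · rw [hY, h1]
  · exact h0 Y hY

theorem mem_onePoint {n : ℕ} {P : Set (Cube n)} {D : Dist n} :
    D ∈ onePoint P ↔ ∃ w ∈ P, D = pointDist w := by
  constructor
  · rintro ⟨w, hw, h⟩
    exact ⟨w, hw, eq_pointDist h⟩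
  · rintro ⟨w, hw, rfl⟩
    exact ⟨w, hw, support_pointDist w⟩

theorem pointDist_mem_onePoint {n : ℕ} {P : Set (Cube n)} {w : Cube n} :
    pointDist w ∈ onePoint P ↔ w ∈ P := by
  constructor
  · rintro ⟨X, hX, h⟩
    rw [support_pointDist, Set.singleton_eq_singleton_iff] at h
    exact h ▸ hX
  · exact fun h => ⟨w, h, support_pointDist w⟩

/-! ### Earth mover distance to a point mass -/

theorem normHamming_nonneg {n : ℕ} (X Y : Cube n) : 0 ≤ normHamming X Y := by
  unfold normHamming; positivity

theorem dist_apply_le_one {n : ℕ} (D : Dist n) (X : Cube n) : D.1 X ≤ 1 := by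
  rw [← D.2.2]
  exact Finset.single_le_sum (fun Y _ => D.2.1 Y) (mem_univ X)

/-- The transport plan that sends all mass to `w` is feasible. -/
theorem emd_pointDist_le {n : ℕ} (D : Dist n) (w : Cube n) :
    emd D (pointDist w) ≤ ∑ X, D.1 X * normHamming X w := by
  refine csInf_le ⟨0, ?_⟩ ⟨fun X Y => if Y = w then D.1 X else 0, ⟨?_, ?_, ?_, ?_⟩, ?_⟩
  · rintro c ⟨f, hf, rfl⟩
    exact Finset.sum_nonneg fun X _ => Finset.sum_nonneg fun Y _ =>
      mul_nonneg (hf.nonneg X Y) (normHamming_nonneg X Y)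
  · intro X Y
    split_ifs
    exacts [D.2.1 X, le_rfl]
  · intro X Y
    split_ifs
    exacts [dist_apply_le_one D X, zero_le_one]
  · intro X
    simp
  · intro Y
    rw [pointDist_apply]
    split_ifs
    exacts [D.2.2, by simp]
  · simp

/-- Between point masses the plan is forced: every column except `w'` vanishes, so row `w` puts its
whole mass on `w'`. -/
theorem normHamming_le_emd {n : ℕ} (w w' : Cube n) :
    normHamming w w' ≤ emd (pointDist w) (pointDist w') := by
  refine le_csInf ⟨_, fun X Y => (pointDist w).1 X * (pointDist w').1 Y, ⟨?_, ?_, ?_, ?_⟩, rfl⟩ ?_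
  · exact fun X Y => mul_nonneg ((pointDist w).2.1 X) ((pointDist w').2.1 Y)
  · exact fun X Y => mul_le_one₀ (dist_apply_le_one _ X) ((pointDist w').2.1 Y)
      (dist_apply_le_one _ Y)
  · intro X
    rw [← Finset.mul_sum, (pointDist w').2.2, mul_one]
  · intro Y
    rw [← Finset.sum_mul, (pointDist w).2.2, one_mul]
  · rintro c ⟨f, hf, rfl⟩
    have hcol : ∀ X Y, Y ≠ w' → f X Y = 0 := fun X Y hY => by
      have h := hf.col Y
      rw [pointDist_apply, if_neg hY] at h
      exact (Finset.sum_eq_zero_iff_of_nonneg fun X _ => hf.nonneg X Y).1 h X (mem_univ X)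
    have hrow : f w w' = 1 := by
      have h := hf.row w
      rw [pointDist_apply, if_pos rfl] at h
      rw [← h]
      exact (Finset.sum_eq_single w' (fun Y _ hY => hcol w Y hY) (by simp)).symm
    calc normHamming w w' = f w w' * normHamming w w' := by rw [hrow, one_mul]
      _ ≤ ∑ Y, f w Y * normHamming w Y :=
        Finset.single_le_sum (f := fun Y => f w Y * normHamming w Y)
          (fun Y _ => mul_nonneg (hf.nonneg w Y) (normHamming_nonneg w Y)) (mem_univ w')
      _ ≤ _ := Finset.single_le_sum (f := fun X => ∑ Y, f X Y * normHamming X Y)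
          (fun X _ => Finset.sum_nonneg fun Y _ =>
            mul_nonneg (hf.nonneg X Y) (normHamming_nonneg X Y)) (mem_univ w)

/-! ### Output probabilities -/

theorem sum_prod_dist {n s : ℕ} (D : Dist n) : ∑ V : Fin s → Cube n, ∏ i, D.1 (V i) = 1 := by
  have h := Finset.prod_univ_sum (fun _ : Fin s => (univ : Finset (Cube n))) fun _ X => D.1 X
  rw [Fintype.piFinset_univ] at h
  rw [← h]
  simp [D.2.2]

theorem summable_law {Ω : Type} (law : PMF Ω) : Summable fun ω => (law ω).toReal :=
  ENNReal.summable_toReal law.tsum_coe_ne_top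

theorem tsum_law {Ω : Type} (law : PMF Ω) : ∑' ω, (law ω).toReal = 1 := by
  rw [← ENNReal.tsum_toReal_eq fun ω => law.apply_ne_top ω, law.tsum_coe, ENNReal.toReal_one]

theorem summable_law_mul {Ω : Type} (law : PMF Ω) {f : Ω → ℝ} {c : ℝ} (h0 : ∀ ω, 0 ≤ f ω)
    (h1 : ∀ ω, f ω ≤ c) : Summable fun ω => (law ω).toReal * f ω :=
  ((summable_law law).mul_right c).of_nonneg_of_le
    (fun ω => mul_nonneg ENNReal.toReal_nonneg (h0 ω))
    fun ω => mul_le_mul_of_nonneg_left (h1 ω) ENNReal.toReal_nonneg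

theorem outputProb_true_add_false {n s : ℕ} {Ω : Type} (law : PMF Ω)
    (run : Ω → (Fin s → Cube n) → Bool) (D : Dist n) :
    outputProb law run D true + outputProb law run D false = 1 := by
  have hsum : ∀ b, Summable fun ω => (law ω).toReal *
      ∑ V : Fin s → Cube n, (∏ i, D.1 (V i)) * (if run ω V = b then 1 else 0) := fun b => by
    refine summable_law_mul law (c := 1) (fun ω => ?_) fun ω => ?_
    · exact Finset.sum_nonneg fun V _ =>
        mul_nonneg (Finset.prod_nonneg fun i _ => D.2.1 _) (by split_ifs <;> norm_num)
    · refine (Finset.sum_le_sum fun V _ => ?_).trans (sum_prod_dist (s := s) D).le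
      exact mul_le_of_le_one_right (Finset.prod_nonneg fun i _ => D.2.1 _)
        (by split_ifs <;> norm_num)
  unfold outputProb
  rw [← (hsum true).tsum_add (hsum false)]
  refine (tsum_congr fun ω => ?_).trans (tsum_law law)
  rw [← mul_add, ← Finset.sum_add_distrib]
  refine Eq.trans ?_ (mul_one (law ω).toReal)
  congr 1
  refine (Finset.sum_congr rfl fun V _ => ?_).trans (sum_prod_dist (s := s) D)
  cases run ω V <;> simp

theorem outputProb_pointDist {n s : ℕ} {Ω : Type} (law : PMF Ω)
    (run : Ω → (Fin s → Cube n) → Bool) (w : Cube n) (b : Bool) :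
    outputProb law run (pointDist w) b =
      ∑' ω, (law ω).toReal * (if run ω (fun _ => w) = b then 1 else 0) := by
  unfold outputProb
  congr 1
  funext ω
  congr 1
  rw [Finset.sum_eq_single fun _ => w]
  · simp [pointDist_apply]
  · intro V _ hV
    obtain ⟨i, hi⟩ := Function.ne_iff.1 hV
    rw [Finset.prod_eq_zero (mem_univ i), zero_mul]
    rw [pointDist_apply, if_neg hi]
  · simp

/-! ### Non-adaptive simulation of adaptive strategies -/

/-- The coordinates of sample `i` that the strategy may query. -/
def QueryTree.coords {s n : ℕ} : QueryTree s n → Fin s → Finset (Fin n)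
  | .leaf _, _ => ∅
  | .query i j next, i' =>
      (if i' = i then {j} else ∅) ∪ ((next false).coords i' ∪ (next true).coords i')

/-- A binary tree of depth `q` has at most `2 ^ q - 1` inner nodes; the `+ 1` avoids truncated
subtraction. -/
theorem QueryTree.sum_card_coords {s n : ℕ} (T : QueryTree s n) :
    ∑ i, (T.coords i).card + 1 ≤ 2 ^ T.depth := by
  induction T with
  | leaf => simp [coords, depth]
  | query i j next ih =>
    have h : ∀ i', ((QueryTree.query i j next).coords i').card ≤
        (if i' = i then 1 else 0) + (((next false).coords i').card + ((next true).coords i').card) := by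
      intro i'
      refine (card_union_le _ _).trans (add_le_add ?_ (card_union_le _ _))
      split_ifs <;> simp
    have h2 := Finset.sum_le_sum fun i' (_ : i' ∈ univ) => h i'
    rw [Finset.sum_add_distrib, Finset.sum_add_distrib, Finset.sum_ite_eq' univ i] at h2
    have hf := (ih false).trans (Nat.pow_le_pow_right two_pos (le_max_left _ (next true).depth))
    have ht := (ih true).trans (Nat.pow_le_pow_right two_pos (le_max_right (next false).depth _))
    simp only [depth, pow_succ]
    simp only [mem_univ, if_true] at h2
    omega

theorem QueryTree.run_congr {s n : ℕ} (T : QueryTree s n) {V W : Fin s → Cube n}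
    (h : ∀ i, ∀ j ∈ T.coords i, V i j = W i j) : T.run V = T.run W := by
  induction T with
  | leaf => rfl
  | query i j next ih =>
    have hij : V i j = W i j := h i j (by simp [coords])
    simp only [run, hij]
    refine ih _ fun i' j' hj' => h i' j' ?_
    simp only [coords, mem_union]
    cases hb : W i j <;> simp only [hb] at hj' <;> tauto

theorem nonadaptivelyTestable_of_adaptivelyTestable {n : ℕ} {P : DistProperty n} {ε : ℝ} {s q : ℕ}
    (h : AdaptivelyTestable P ε s q) : NonadaptivelyTestable P ε s (2 ^ q - 1) := by
  obtain ⟨A, hA⟩ := h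
  -- The default `false` stands only at coordinates that no branch of the tree reads.
  refine ⟨⟨A.Coins, A.law, fun ω => (A.tree ω).coords, fun ω => ?_, fun ω V =>
    (A.tree ω).run fun i j => if h : j ∈ (A.tree ω).coords i then V i j h else false⟩, ?_⟩
  · have := (A.tree ω).sum_card_coords
    have := Nat.pow_le_pow_right two_pos (A.depth_le ω)
    omega
  · convert hA using 3 with ω V
    refine (A.tree ω).run_congr fun i j hj => ?_
    simp [hj]

/-! ### Encoded words -/

/-- The position of the high bit of letter `i`. -/
def hiPos {n : ℕ} (i : Fin n) : Fin (2 * n) := ⟨2 * i.1, by omega⟩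

/-- The position of the low bit of letter `i`. -/
def loPos {n : ℕ} (i : Fin n) : Fin (2 * n) := ⟨2 * i.1 + 1, by omega⟩

/-- The letter to which bit `j` belongs. -/
def letterPos {n : ℕ} (j : Fin (2 * n)) : Fin n := ⟨j.1 / 2, by omega⟩

/-- The low bits of the letters of an encoded word. -/
def lowBits {n : ℕ} (w : Cube (2 * n)) : Cube n := fun i => w (loPos i)

/-- The word with letters from `{0,1}` before position `k`, letters from `{2,3}` from there on,
and low bits `u`. -/
def encode {n : ℕ} (k : Fin (n + 1)) (u : Cube n) : Cube (2 * n) := fun j =>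
  if j.1 % 2 = 0 then decide (k.1 ≤ j.1 / 2) else u (letterPos j)

@[simp] theorem encode_hiPos {n : ℕ} (k : Fin (n + 1)) (u : Cube n) (i : Fin n) :
    encode k u (hiPos i) = decide (k.1 ≤ i.1) := by
  simp [encode, hiPos]

@[simp] theorem encode_loPos {n : ℕ} (k : Fin (n + 1)) (u : Cube n) (i : Fin n) :
    encode k u (loPos i) = u i := by
  have h : letterPos (loPos i) = i := Fin.ext (by simp [letterPos, loPos]; omega)
  have h' : (loPos i).1 % 2 ≠ 0 := by simp [loPos]
  simp [encode, h, h']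

@[simp] theorem lowBits_encode {n : ℕ} (k : Fin (n + 1)) (u : Cube n) :
    lowBits (encode k u) = u := by
  funext i
  simp [lowBits]

theorem bits_ext {n : ℕ} {w w' : Cube (2 * n)} (h0 : ∀ i, w (hiPos i) = w' (hiPos i))
    (h1 : ∀ i, w (loPos i) = w' (loPos i)) : w = w' := by
  funext j
  rcases Nat.even_or_odd' j.1 with ⟨c, hc | hc⟩
  · have : j = hiPos ⟨c, by omega⟩ := Fin.ext hc
    rw [this, h0]
  · have : j = loPos ⟨c, by omega⟩ := Fin.ext hc
    rw [this, h1]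

/-- The reflection of positions that reverses the first `k` and the last `n - k` letters. -/
def mirror {n : ℕ} (k : Fin (n + 1)) (i : Fin n) : Fin n :=
  if h : i.1 < k.1 then ⟨k.1 - 1 - i.1, by omega⟩ else ⟨n - 1 + k.1 - i.1, by have := i.2; omega⟩

theorem mirror_val {n : ℕ} (k : Fin (n + 1)) (i : Fin n) :
    (mirror k i).1 = if i.1 < k.1 then k.1 - 1 - i.1 else n - 1 + k.1 - i.1 := by
  unfold mirror; split_ifs <;> rfl

theorem mirror_involutive {n : ℕ} (k : Fin (n + 1)) : Function.Involutive (mirror k) := by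
  intro i
  have := i.2
  have := k.2
  ext
  simp only [mirror_val]
  split_ifs <;> omega

theorem letter_low {a b : Bool} : (letter a b = 0 ∨ letter a b = 1) ↔ a = false := by
  cases a <;> cases b <;> decide

theorem letter_high {a b : Bool} : (letter a b = 2 ∨ letter a b = 3) ↔ a = true := by
  cases a <;> cases b <;> decide

theorem letter_injective {a b a' b' : Bool} (h : letter a b = letter a' b') : b = b' := by
  revert h; cases a <;> cases b <;> cases a' <;> cases b' <;> decide

theorem length_decode {n : ℕ} (w : Cube (2 * n)) : (decode w).length = n := by
  simp [decode]

theorem getElem_decode {n : ℕ} (w : Cube (2 * n)) (i : ℕ) (h : i < (decode w).length) :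
    (decode w)[i] = letter (w (hiPos ⟨i, by simpa [length_decode] using h⟩))
      (w (loPos ⟨i, by simpa [length_decode] using h⟩)) := by
  simp [decode, hiPos, loPos]

/-- The threshold `k` is the length of the first palindrome; `k = 0` and `k = n` are the cases of an
empty block. High bits tell the two alphabets apart, so being a palindrome only constrains the low
bits. -/
theorem isPal_decode_iff {n : ℕ} (w : Cube (2 * n)) :
    IsPal (decode w) ↔ ∃ (k : Fin (n + 1)) (u : Cube n), (∀ i, u (mirror k i) = u i) ∧
      w = encode k u := by
  constructor
  · rintro ⟨X, Y, hS, hX, hX01, hY, hY23⟩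
    have hlen : X.length + Y.length = n := by
      rw [← List.length_append, ← hS, length_decode]
    have hw : ∀ i : Fin n, letter (w (hiPos i)) (w (loPos i)) =
        (X ++ Y)[i.1]'(by rw [List.length_append]; omega) := fun i => by
      simp only [← hS, getElem_decode]
    have hhi : ∀ i : Fin n, w (hiPos i) = decide (X.length ≤ i.1) := by
      intro i
      have h := hw i
      by_cases hi : i.1 < X.length
      · rw [List.getElem_append_left hi] at h
        have := letter_low.1 (h ▸ hX01 _ (List.getElem_mem hi))
        rw [this, decide_eq_false (not_le.2 hi)]
      · rw [List.getElem_append_right (not_lt.1 hi)] at h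
        have := letter_high.1 (h ▸ hY23 _ (List.getElem_mem _))
        rw [this, decide_eq_true (not_lt.1 hi)]
    refine ⟨⟨X.length, by omega⟩, lowBits w, fun i => ?_, bits_ext (fun i => ?_) fun i => ?_⟩
    · refine letter_injective ((hw _).trans (Eq.trans ?_ (hw i).symm))
      have hm := mirror_val ⟨X.length, by omega⟩ i
      simp only at hm
      simp only [hm]
      by_cases hi : i.1 < X.length
      · simp only [if_pos hi]
        rw [List.getElem_append_left hi, List.getElem_append_left (by omega)]
        exact (List.getElem_reverse (by simpa using hi)).symm.trans
          (List.getElem_of_eq hX.reverse_eq _)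
      · simp only [if_neg hi]
        rw [List.getElem_append_right (by omega), List.getElem_append_right (by omega)]
        refine Eq.trans ?_ ((List.getElem_reverse (by rw [List.length_reverse]; omega)).symm.trans
          (List.getElem_of_eq hY.reverse_eq _))
        congr 1
        omega
    · rw [hhi, encode_hiPos]
    · rw [encode_loPos, lowBits]
  · rintro ⟨k, u, hu, rfl⟩
    have hk := k.2
    have hlen := length_decode (encode k u)
    have hget : ∀ (i : ℕ) (h : i < (decode (encode k u)).length), (decode (encode k u))[i] =
        letter (decide (k.1 ≤ i)) (u ⟨i, by omega⟩) := by
      intro i h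
      rw [getElem_decode, encode_hiPos, encode_loPos]
    refine ⟨(decode (encode k u)).take k.1, (decode (encode k u)).drop k.1,
      (List.take_append_drop _ _).symm, List.Palindrome.of_reverse_eq ?_, ?_,
      List.Palindrome.of_reverse_eq ?_, ?_⟩
    · refine List.ext_getElem (by simp) fun i h1 h2 => ?_
      have hi : i < k.1 := by simp at h2; omega
      rw [List.getElem_reverse, List.getElem_take, List.getElem_take, hget, hget]
      have hl : (List.take k.1 (decode (encode k u))).length = k.1 := by simp; omega
      simp only [hl]
      congr 1
      · rw [decide_eq_false (by omega), decide_eq_false (by omega)]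
      · rw [← hu ⟨i, by omega⟩]
        congr 1
        ext
        rw [mirror_val, if_pos hi]
    · intro a ha
      obtain ⟨i, hi, rfl⟩ := List.getElem_of_mem ha
      rw [List.getElem_take, hget]
      rw [List.length_take] at hi
      exact letter_low.2 (decide_eq_false (by omega))
    · refine List.ext_getElem (by simp) fun i h1 h2 => ?_
      have hi : i + k.1 < n := by simp at h2; omega
      rw [List.getElem_reverse, List.getElem_drop, List.getElem_drop, hget, hget]
      have hl : (List.drop k.1 (decode (encode k u))).length = n - k.1 := by simp; omega
      simp only [hl]
      congr 1
      · rw [decide_eq_true (by omega), decide_eq_true (by omega)]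
      · rw [← hu ⟨k.1 + i, by omega⟩]
        congr 1
        ext
        rw [mirror_val, if_neg (by simp)]
        simp only
        omega
    · intro a ha
      obtain ⟨i, hi, rfl⟩ := List.getElem_of_mem ha
      rw [List.getElem_drop, hget]
      exact letter_high.2 (decide_eq_true (by omega))

theorem pointDist_mem_onePal_iff {n : ℕ} (w : Cube (2 * n)) :
    pointDist w ∈ onePal n ↔ ∃ (k : Fin (n + 1)) (u : Cube n), (∀ i, u (mirror k i) = u i) ∧
      w = encode k u :=
  pointDist_mem_onePoint.trans (isPal_decode_iff w)

/-- The low bits `u`, made symmetric under `mirror k` by copying from the left. -/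
def symmetrize {n : ℕ} (k : Fin (n + 1)) (u : Cube n) : Cube n := fun i => u (min i (mirror k i))

theorem symmetrize_mirror {n : ℕ} (k : Fin (n + 1)) (u : Cube n) (i : Fin n) :
    symmetrize k u (mirror k i) = symmetrize k u i := by
  simp only [symmetrize, mirror_involutive k i, min_comm]

theorem symmetrize_eq_self {n : ℕ} {k : Fin (n + 1)} {u : Cube n}
    (h : ∀ i, u (mirror k i) = u i) : symmetrize k u = u := by
  funext i
  rcases min_choice i (mirror k i) with h' | h' <;> simp only [symmetrize, h']
  exact h i

theorem encode_symmetrize_mem {n : ℕ} (k : Fin (n + 1)) (u : Cube n) :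
    pointDist (encode k (symmetrize k u)) ∈ onePal n :=
  (pointDist_mem_onePal_iff _).2 ⟨k, _, symmetrize_mirror k u, rfl⟩

/-! ### Failure of index-invariance -/

theorem permute_pointDist {n : ℕ} (σ : Equiv.Perm (Fin n)) (w : Cube n) :
    permute σ (pointDist w) = pointDist (w ∘ σ) := by
  refine Subtype.ext (funext fun X => ?_)
  show (pointDist w).1 (X ∘ σ.symm) = _
  rw [pointDist_apply, pointDist_apply]
  congr 1
  exact propext (Equiv.comp_symm_eq σ w X)

/-- The word `0…02` is in the property; exchanging the high bits of its first and last letters gives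
a word that starts with `2` and ends with `0`. -/
theorem not_indexInvariant_onePal {n : ℕ} (hn : 2 ≤ n) : ¬ IndexInvariant (onePal n) := by
  intro h
  let a : Fin n := ⟨0, by omega⟩
  let b : Fin n := ⟨n - 1, by omega⟩
  let k : Fin (n + 1) := ⟨n - 1, by omega⟩
  let w : Cube (2 * n) := encode k fun _ => false
  let σ : Equiv.Perm (Fin (2 * n)) := Equiv.swap (hiPos a) (hiPos b)
  have hw : pointDist w ∈ onePal n :=
    (pointDist_mem_onePal_iff _).2 ⟨k, _, fun _ => rfl, rfl⟩
  have h2 := (h _ σ).1 hw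
  rw [permute_pointDist] at h2
  obtain ⟨k', u, -, hu⟩ := (pointDist_mem_onePal_iff _).1 h2
  have h3 := congrFun hu (hiPos a)
  have h4 := congrFun hu (hiPos b)
  simp only [Function.comp, σ, Equiv.swap_apply_left, Equiv.swap_apply_right, w, encode_hiPos] at h3 h4
  simp only [k, a, b, decide_eq_decide] at h3 h4
  omega

/-! ### The adaptive tester -/

/-- Binary search for the first position with bit `true` among `lo, …, lo + 2 ^ d - 1`. -/
def searchVal {n : ℕ} (h : Fin n → Bool) : ℕ → ℕ → ℕ
  | 0, lo => lo
  | d + 1, lo =>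
    if hp : lo + 2 ^ d - 1 < n then
      bif h ⟨lo + 2 ^ d - 1, hp⟩ then searchVal h d lo else searchVal h d (lo + 2 ^ d)
    -- Positions from `n` on count as `true` and cost no query, so the range may be padded to a
    -- power of two.
    else searchVal h d lo

theorem searchVal_eq {n : ℕ} {h : Fin n → Bool} {k : ℕ} (hk : k ≤ n)
    (hh : ∀ i, h i = decide (k ≤ i.1)) (d lo : ℕ) (h1 : lo ≤ k) (h2 : k < lo + 2 ^ d) :
    searchVal h d lo = k := by
  induction d generalizing lo with
  | zero => simp only [searchVal]; simp at h2; omega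
  | succ d ih =>
    have hpos : 0 < 2 ^ d := by positivity
    rw [pow_succ] at h2
    simp only [searchVal, hh]
    split_ifs with hp
    · by_cases hle : k ≤ lo + 2 ^ d - 1
      · simp only [hle, decide_true, cond_true]
        exact ih _ h1 (by omega)
      · simp only [hle, decide_false, cond_false]
        exact ih _ (by omega) (by omega)
    · exact ih _ h1 (by omega)

/-- The value found by binary search, as a possible number of letters from `{0,1}`. -/
def boundary {n : ℕ} (w : Cube (2 * n)) (d lo : ℕ) : Fin (n + 1) :=
  Fin.clamp (searchVal (fun i => w (hiPos i)) d lo) n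

/-- The inequality `n < 2 ^ d` is strict because there are `n + 1` candidates, `k = n` included. -/
theorem boundary_encode {n : ℕ} (k : Fin (n + 1)) (u : Cube n) (d : ℕ) (hd : n < 2 ^ d) :
    boundary (encode k u) d 0 = k := by
  have hk := k.2
  refine Fin.ext ?_
  simp only [boundary, Fin.coe_clamp]
  rw [searchVal_eq (k := k.1) (by omega) (fun i => encode_hiPos k u i) d 0 (by omega) (by omega)]
  omega

/-- Binary search on the high bits of sample `i`, followed by a strategy that depends on its
outcome. -/
def searchTree {s n : ℕ} (i : Fin s) (cont : Fin (n + 1) → QueryTree s (2 * n)) :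
    ℕ → ℕ → QueryTree s (2 * n)
  | 0, lo => cont (Fin.clamp lo n)
  | d + 1, lo =>
    if hp : lo + 2 ^ d - 1 < n then
      .query i (hiPos ⟨lo + 2 ^ d - 1, hp⟩) fun b =>
        bif b then searchTree i cont d lo else searchTree i cont d (lo + 2 ^ d)
    else searchTree i cont d lo

theorem run_searchTree {s n : ℕ} (i : Fin s) (cont : Fin (n + 1) → QueryTree s (2 * n))
    (d lo : ℕ) (V : Fin s → Cube (2 * n)) :
    (searchTree i cont d lo).run V = (cont (boundary (V i) d lo)).run V := by
  induction d generalizing lo with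
  | zero => rfl
  | succ d ih =>
    unfold searchTree boundary searchVal
    split_ifs with hp
    · simp only [QueryTree.run]
      cases V i (hiPos ⟨lo + 2 ^ d - 1, hp⟩)
      · exact ih _
      · exact ih _
    · exact ih _

theorem depth_searchTree {s n : ℕ} (i : Fin s) {cont : Fin (n + 1) → QueryTree s (2 * n)} {m : ℕ}
    (hm : ∀ k, (cont k).depth ≤ m) (d lo : ℕ) : (searchTree i cont d lo).depth ≤ m + d := by
  induction d generalizing lo with
  | zero => exact hm _
  | succ d ih =>
    unfold searchTree
    have h1 := ih lo
    have h2 := ih (lo + 2 ^ d)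
    split_ifs
    · simp only [QueryTree.depth, cond_true, cond_false]
      omega
    · omega

/-- For each pair `(i, j)` in the list, compare bit `j` of sample `i` with bit `j` of the
symmetrization of sample `i₀` with boundary `k`. -/
def compareTree {s n : ℕ} (i₀ : Fin s) (k : Fin (n + 1)) :
    List (Fin s × Fin (2 * n)) → QueryTree s (2 * n)
  | [] => .leaf true
  | (i, j) :: l =>
    -- This first query is made even if `j` is a high bit, whose target `k` already determines;
    -- every pair then costs two queries.
    .query i₀ (loPos (min (letterPos j) (mirror k (letterPos j)))) fun b => .query i j fun c =>
      bif c == (if j.1 % 2 = 0 then decide (k.1 ≤ j.1 / 2) else b) then compareTree i₀ k l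
      else .leaf false

theorem run_compareTree {s n : ℕ} (i₀ : Fin s) (k : Fin (n + 1)) (l : List (Fin s × Fin (2 * n)))
    (V : Fin s → Cube (2 * n)) : (compareTree i₀ k l).run V = true ↔
      ∀ p ∈ l, V p.1 p.2 = encode k (symmetrize k (lowBits (V i₀))) p.2 := by
  induction l with
  | nil => simp [compareTree, QueryTree.run]
  | cons p l ih =>
    obtain ⟨i, j⟩ := p
    have he : encode k (symmetrize k (lowBits (V i₀))) j = (if j.1 % 2 = 0 then
        decide (k.1 ≤ j.1 / 2) else
        V i₀ (loPos (min (letterPos j) (mirror k (letterPos j))))) := rfl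
    simp only [compareTree, QueryTree.run, List.forall_mem_cons, ← ih, he]
    by_cases h : V i j = (if j.1 % 2 = 0 then decide (k.1 ≤ j.1 / 2) else
        V i₀ (loPos (min (letterPos j) (mirror k (letterPos j)))))
    · simp [h]
    · simp [beq_eq_false_iff_ne.2 h, h, QueryTree.run]

theorem depth_compareTree {s n : ℕ} (i₀ : Fin s) (k : Fin (n + 1))
    (l : List (Fin s × Fin (2 * n))) : (compareTree i₀ k l).depth ≤ 2 * l.length := by
  induction l with
  | nil => simp [compareTree, QueryTree.depth]
  | cons p l ih =>
    obtain ⟨i, j⟩ := p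
    have h : ∀ a c : Bool, (bif a == c then compareTree i₀ k l else QueryTree.leaf false).depth ≤
        2 * l.length := fun a c => by
      cases a == c
      · simp [QueryTree.depth]
      · exact ih
    simp only [compareTree, QueryTree.depth, List.length_cons]
    have h1 := h false
    have h2 := h true
    refine le_trans (Nat.add_le_add_right (max_le (Nat.add_le_add_right (max_le (h1 _) (h2 _)) 1)
      (Nat.add_le_add_right (max_le (h1 _) (h2 _)) 1)) 1) (by omega)

/-! ### Comparing fresh samples with a target computed from the first one -/

/-- Exchanging the sums counts, for each `X`, the coordinates where it agrees with `w`. -/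
theorem sum_agree {n : ℕ} (hn : 0 < n) (D : Dist n) (w : Cube n) :
    ∑ j : Fin n, ∑ X, D.1 X * (if X j = w j then 1 else 0) =
      n * (1 - ∑ X, D.1 X * normHamming X w) := by
  have hX : ∀ X : Cube n, ∑ j : Fin n, (if X j = w j then (1 : ℝ) else 0) =
      n * (1 - normHamming X w) := fun X => by
    have h : ∀ j : Fin n, (if X j = w j then (1 : ℝ) else 0) = 1 - if X j ≠ w j then 1 else 0 :=
      fun j => by by_cases h : X j = w j <;> simp [h]
    simp only [h]
    rw [Finset.sum_sub_distrib, Finset.sum_boole]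
    have : (0 : ℝ) < n := by exact_mod_cast hn
    simp only [normHamming, hammingDist, sum_const, card_univ, Fintype.card_fin, nsmul_eq_mul]
    field_simp
  rw [Finset.sum_comm]
  simp only [← Finset.mul_sum, hX]
  rw [show ∑ X, D.1 X * (n * (1 - normHamming X w)) =
    n * (∑ X, D.1 X - ∑ X, D.1 X * normHamming X w) by
      rw [← Finset.sum_sub_distrib, Finset.mul_sum]
      exact Finset.sum_congr rfl fun X _ => by ring, D.2.2]

/-- The probability that `m` fresh samples, each in one uniformly random coordinate, agree with a
target that depends on the first sample. -/
theorem outputProb_compare {n m : ℕ} [NeZero n] (g : Cube n → Cube n) (D : Dist n)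
    (run : (Fin m → Fin n) → (Fin (m + 1) → Cube n) → Bool)
    (hrun : ∀ ω V, run ω V = true ↔ ∀ t : Fin m, V t.succ (ω t) = g (V 0) (ω t)) :
    outputProb (PMF.uniformOfFintype (Fin m → Fin n)) run D true =
      ∑ X, D.1 X * (1 - ∑ Y, D.1 Y * normHamming Y (g X)) ^ m := by
  have hn : (0 : ℝ) < n := by exact_mod_cast Nat.pos_of_neZero n
  have hinner : ∀ ω : Fin m → Fin n, ∑ V : Fin (m + 1) → Cube n,
      (∏ i, D.1 (V i)) * (if run ω V = true then (1 : ℝ) else 0) =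
      ∑ X, D.1 X * ∏ t, ∑ Y, D.1 Y * (if Y (ω t) = g X (ω t) then 1 else 0) := by
    intro ω
    -- Given the first sample the target is fixed, and independence of the fresh samples yields a
    -- product.
    rw [← Equiv.sum_comp (Fin.consEquiv fun _ : Fin (m + 1) => Cube n), Fintype.sum_prod_type]
    refine Finset.sum_congr rfl fun X _ => ?_
    have h := Finset.prod_univ_sum (fun _ : Fin m => (univ : Finset (Cube n)))
      fun t Y => D.1 Y * (if Y (ω t) = g X (ω t) then (1 : ℝ) else 0)
    rw [Fintype.piFinset_univ] at h
    rw [h, Finset.mul_sum]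
    refine Finset.sum_congr rfl fun V _ => ?_
    rw [Finset.prod_mul_distrib, Finset.prod_ite_zero, Finset.prod_const_one]
    simp only [hrun, Fin.consEquiv_apply, Fin.prod_univ_succ, Fin.cons_zero, Fin.cons_succ,
      mem_univ, true_imp_iff, mul_assoc]
  unfold outputProb
  rw [tsum_fintype]
  simp only [hinner, PMF.uniformOfFintype_apply, Fintype.card_pi, Finset.prod_const,
    Fintype.card_fin, card_univ]
  rw [← Finset.mul_sum, Finset.sum_comm, Finset.mul_sum]
  refine Finset.sum_congr rfl fun X _ => ?_
  -- The coordinates are independent as well, so averaging over them gives an `m`-th power.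
  have h := Finset.prod_univ_sum (fun _ : Fin m => (univ : Finset (Fin n)))
    fun _ j => ∑ Y, D.1 Y * (if Y j = g X j then (1 : ℝ) else 0)
  rw [Fintype.piFinset_univ, Finset.prod_const] at h
  rw [← Finset.mul_sum, ← h, sum_agree (Nat.pos_of_neZero n), card_univ, Fintype.card_fin, mul_pow]
  simp only [Nat.cast_pow, ENNReal.toReal_inv, ENNReal.toReal_pow, ENNReal.toReal_natCast]
  field_simp

theorem adaptivelyTestable_onePal {n : ℕ} (hn : 2 ≤ n) {ε : ℝ} {m d : ℕ}
    (hm : (1 - ε) ^ m ≤ 1 / 3) (hd : n < 2 ^ d) :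
    AdaptivelyTestable (onePal n) ε (m + 1) (2 * m + d) := by
  have : NeZero (2 * n) := ⟨by omega⟩
  let g : Cube (2 * n) → Cube (2 * n) := fun w =>
    encode (boundary w d 0) (symmetrize (boundary w d 0) (lowBits w))
  let tree : (Fin m → Fin (2 * n)) → QueryTree (m + 1) (2 * n) := fun ω =>
    searchTree 0 (fun k => compareTree 0 k (List.ofFn fun t => (t.succ, ω t))) d 0
  have hrun : ∀ ω V, (tree ω).run V = true ↔ ∀ t : Fin m, V t.succ (ω t) = g (V 0) (ω t) := by
    intro ω V
    simp only [tree, run_searchTree, run_compareTree, List.forall_mem_ofFn_iff, g]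
  refine ⟨⟨Fin m → Fin (2 * n), PMF.uniformOfFintype _, tree, fun ω => ?_⟩, ?_, ?_⟩
  · refine depth_searchTree 0 (fun k => (depth_compareTree 0 k _).trans ?_) d 0
    rw [List.length_ofFn]
  · intro D hD
    obtain ⟨w, hw, rfl⟩ := mem_onePoint.1 hD
    obtain ⟨k, u, hu, rfl⟩ := (isPal_decode_iff w).1 hw
    -- Completeness: `g` fixes the words of the property, so all comparisons succeed.
    have hg : g (encode k u) = encode k u := by
      simp only [g, boundary_encode k u d hd, lowBits_encode, symmetrize_eq_self hu]
    rw [outputProb_pointDist, tsum_congr fun ω => by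
      rw [if_pos ((hrun ω _).2 fun t => by rw [hg]), mul_one], tsum_law]
    norm_num
  · intro D hD
    have h1 := outputProb_true_add_false (PMF.uniformOfFintype (Fin m → Fin (2 * n)))
      (fun ω V => (tree ω).run V) D
    rw [outputProb_compare g D _ hrun] at h1
    have h2 : ∑ X, D.1 X * (1 - ∑ Y, D.1 Y * normHamming Y (g X)) ^ m ≤ 1 / 3 := by
      calc _ ≤ ∑ X, D.1 X * (1 / 3) := by
            refine Finset.sum_le_sum fun X _ => mul_le_mul_of_nonneg_left ?_ (D.2.1 X)
            refine le_trans (pow_le_pow_left₀ ?_ ?_ m) hm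
            · rw [sub_nonneg, ← D.2.2]
              refine Finset.sum_le_sum fun Y _ => mul_le_of_le_one_right (D.2.1 Y) ?_
              refine div_le_one_of_le₀ ?_ (Nat.cast_nonneg _)
              exact_mod_cast hammingDist_le_card_fintype.trans (by simp)
            -- Soundness: `g X` is in the property for every `X`, even when the high bits of `X` are
            -- not monotone and the search result means nothing.
            · have := (hD _ (encode_symmetrize_mem (boundary X d 0) (lowBits X))).trans_le
                (emd_pointDist_le D _)
              linarith
        _ = 1 / 3 := by rw [← Finset.sum_mul, D.2.2, one_mul]
    linarith

theorem exists_adaptive_tester {ε : ℝ} (h0 : 0 < ε) :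
    ∃ C : ℝ, 0 < C ∧ ∀ n : ℕ, 2 ≤ n → ∃ s q : ℕ, (q : ℝ) ≤ C * Real.log n ∧
      AdaptivelyTestable (onePal n) ε s q := by
  obtain ⟨m, hm⟩ := exists_pow_lt_of_lt_one (show (0 : ℝ) < 1 / 3 by norm_num)
    (show 1 - ε < 1 by linarith)
  have hlog2 : 0 < Real.log 2 := Real.log_pos (by norm_num)
  -- As `log n / log 2 ≥ 1`, it absorbs the additive `2 * m + 1`.
  refine ⟨(2 * m + 2) / Real.log 2, by positivity, fun n hn => ⟨m + 1, 2 * m + (Nat.log 2 n + 1),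
    ?_, adaptivelyTestable_onePal hn hm.le (Nat.lt_pow_succ_log_self one_lt_two n)⟩⟩
  have hn' : (2 : ℝ) ≤ n := by exact_mod_cast hn
  have hlog : 1 ≤ Real.log n / Real.log 2 := by
    rw [le_div_iff₀ hlog2, one_mul]
    exact Real.log_le_log (by norm_num) hn'
  have h2 : (Nat.log 2 n : ℝ) ≤ Real.log n / Real.log 2 := by
    simpa [Real.logb] using Real.natLog_le_logb n 2
  rw [div_mul_eq_mul_div, mul_div_assoc]
  push_cast
  nlinarith [(Nat.cast_nonneg m : (0 : ℝ) ≤ m)]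

/-! ### Few queries rarely hit two mirrored positions -/

/-- The values of `k` for which two different positions in `Q` are mirrored to each other. -/
def collisions {n : ℕ} (Q : Finset (Fin n)) : Finset (Fin n) :=
  univ.filter fun k => ∃ i ∈ Q, mirror k.castSucc i ∈ Q ∧ mirror k.castSucc i ≠ i

/-- Mirrored positions `i`, `i'` satisfy `i + i' + 1 ≡ k` modulo `n` in either block, so a pair
determines `k`. The threshold `n` is left out, since it gives the same reflection as `0`. -/
theorem card_collisions_le {n : ℕ} (Q : Finset (Fin n)) :
    (collisions Q).card ≤ Q.card ^ 2 := by
  rw [sq, ← card_product]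
  have : collisions Q ⊆ (Q ×ˢ Q).image fun p =>
      ⟨(p.1.1 + p.2.1 + 1) % n, Nat.mod_lt _ (by have := p.1.2; omega)⟩ := by
    intro k hk
    obtain ⟨i, hi, hi', -⟩ := (mem_filter.1 hk).2
    refine mem_image.2 ⟨(i, mirror k.castSucc i), mem_product.2 ⟨hi, hi'⟩, Fin.ext ?_⟩
    have := i.2
    have := k.2
    simp only [mirror_val, Fin.val_castSucc]
    split_ifs with h
    · rw [show i.1 + (k.1 - 1 - i.1) + 1 = k.1 by omega, Nat.mod_eq_of_lt k.2]
    · rw [show i.1 + (n - 1 + k.1 - i.1) + 1 = k.1 + n by omega, Nat.add_mod_right,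
        Nat.mod_eq_of_lt k.2]
  exact (card_le_card this).trans card_image_le

/-- Restricted to a set without mirrored positions, a symmetrized uniform string is uniform. -/
theorem sum_symmetrize {n : ℕ} {Q : Finset (Fin n)} {k : Fin n} (hk : k ∉ collisions Q)
    {F : Cube n → ℝ} (hF : ∀ u v, (∀ i ∈ Q, u i = v i) → F u = F v) :
    ∑ u, F (symmetrize k.castSucc u) = ∑ u, F u := by
  have hk' : ∀ i ∈ Q, mirror k.castSucc i ∈ Q → mirror k.castSucc i = i := by
    simpa [collisions] using hk
  -- `τ` swaps a mirrored pair exactly when its larger element is in `Q`. On `Q` the symmetrization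
  -- of `u` is then `u ∘ τ`, and composing with an involution permutes the strings.
  let τ : Fin n → Fin n := fun i =>
    if (i ∈ Q ∧ mirror k.castSucc i < i) ∨
      (mirror k.castSucc i ∈ Q ∧ i < mirror k.castSucc i) then mirror k.castSucc i else i
  have hτ : Function.Involutive τ := by
    intro i
    by_cases h : (i ∈ Q ∧ mirror k.castSucc i < i) ∨
      (mirror k.castSucc i ∈ Q ∧ i < mirror k.castSucc i)
    · have h1 : τ i = mirror k.castSucc i := if_pos h
      rw [h1]
      simp only [τ, mirror_involutive k.castSucc i]
      rw [if_pos h.symm]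
    · have h1 : τ i = i := if_neg h
      rw [h1, h1]
  rw [← Equiv.sum_comp (hτ.toPerm.arrowCongr (Equiv.refl Bool)) F]
  refine Finset.sum_congr rfl fun u _ => hF _ _ fun i hi => ?_
  show u (min i (mirror k.castSucc i)) = u (τ i)
  congr 1
  rcases lt_trichotomy i (mirror k.castSucc i) with h | h | h
  · rw [min_eq_left h.le]
    refine (if_neg ?_).symm
    rintro (h' | h')
    · exact lt_asymm h h'.2
    · exact h.ne' (hk' i hi h'.1)
  · simp only [τ, ← h, min_self, ite_self]
  · rw [min_eq_right h.le]
    exact (if_pos (Or.inl ⟨hi, h⟩)).symm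

/-- Averaged over `k`, a test of few letters hardly distinguishes symmetrized strings from
uniform ones. -/
theorem sum_encode_symmetrize_le {n : ℕ} {Q : Finset (Fin n)} {a : Cube (2 * n) → ℝ}
    (h0 : ∀ w, 0 ≤ a w) (h1 : ∀ w, a w ≤ 1)
    (ha : ∀ w w', (∀ j, letterPos j ∈ Q → w j = w' j) → a w = a w') :
    ∑ p : Fin n × Cube n, a (encode p.1.castSucc (symmetrize p.1.castSucc p.2)) ≤
      ∑ p : Fin n × Cube n, a (encode p.1.castSucc p.2) + (Q.card : ℝ) ^ 2 * 2 ^ n := by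
  rw [Fintype.sum_prod_type, Fintype.sum_prod_type]
  have hk : ∀ k : Fin n, ∑ u, a (encode k.castSucc (symmetrize k.castSucc u)) ≤
      ∑ u, a (encode k.castSucc u) + if k ∈ collisions Q then (2 : ℝ) ^ n else 0 := by
    intro k
    split_ifs with h
    -- For a threshold with a collision the trivial bound `2 ^ n` is used.
    · refine le_add_of_nonneg_of_le (Finset.sum_nonneg fun u _ => h0 _) ?_
      refine (Finset.sum_le_sum fun u _ => h1 _).trans ?_
      simp
    · rw [add_zero]
      refine (sum_symmetrize h (F := fun u => a (encode k.castSucc u)) fun u v huv => ?_).le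
      refine ha _ _ fun j hj => ?_
      simp only [encode, huv _ hj]
  refine (Finset.sum_le_sum fun k _ => hk k).trans ?_
  rw [Finset.sum_add_distrib, Finset.sum_ite_mem, univ_inter, sum_const, nsmul_eq_mul]
  gcongr
  exact_mod_cast card_collisions_le Q

theorem sum_tsum_law_le {ι Ω : Type} [Fintype ι] (law : PMF Ω) {f g : ι → Ω → ℝ} {c : ℝ}
    (hf0 : ∀ i ω, 0 ≤ f i ω) (hf1 : ∀ i ω, f i ω ≤ 1) (hg0 : ∀ i ω, 0 ≤ g i ω)
    (hg1 : ∀ i ω, g i ω ≤ 1) (h : ∀ ω, ∑ i, f i ω ≤ ∑ i, g i ω + c) :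
    ∑ i, ∑' ω, (law ω).toReal * f i ω ≤ ∑ i, ∑' ω, (law ω).toReal * g i ω + c := by
  have sf := fun i => summable_law_mul law (hf0 i) (hf1 i)
  have sg := fun i => summable_law_mul law (hg0 i) (hg1 i)
  have sc := (summable_law law).mul_right c
  rw [← Summable.tsum_finsetSum fun i _ => sf i, ← Summable.tsum_finsetSum fun i _ => sg i]
  conv_rhs => rw [← one_mul c, ← tsum_law law, ← tsum_mul_right]
  rw [← (summable_sum fun i _ => sg i).tsum_add sc]
  refine Summable.tsum_le_tsum (fun ω => ?_) (summable_sum fun i _ => sf i)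
    ((summable_sum fun i _ => sg i).add sc)
  rw [← Finset.mul_sum, ← Finset.mul_sum, ← mul_add]
  exact mul_le_mul_of_nonneg_left (h ω) ENNReal.toReal_nonneg

/-! ### Most strings are far from symmetric -/

/-- The strings within Hamming distance `r` of one that is symmetric under some `mirror k`. -/
def nearSymmetric (n r : ℕ) : Finset (Cube n) :=
  univ.filter fun u => ∃ (k : Fin (n + 1)) (v : Cube n),
    (∀ i, v (mirror k i) = v i) ∧ hammingDist u v ≤ r

theorem hammingDist_le_encode {n : ℕ} (k k' : Fin (n + 1)) (u v : Cube n) :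
    hammingDist u v ≤ hammingDist (encode k u) (encode k' v) := by
  refine card_le_card_of_injOn loPos (fun i hi => ?_) fun i _ i' _ h => ?_
  · simpa using hi
  · simpa [loPos, Fin.ext_iff] using h

/-- Differences in low bits alone suffice, whatever threshold the nearest word has; `2 * n` is the
length of the encoded word. -/
theorem isFar_encode {n r : ℕ} {ε : ℝ} (hr : 2 * n * ε < r + 1) (hn : 0 < n) (k : Fin (n + 1))
    {u : Cube n} (hu : u ∉ nearSymmetric n r) : IsFar ε (pointDist (encode k u)) (onePal n) := by
  intro D' hD'
  obtain ⟨w, hw, rfl⟩ := mem_onePoint.1 hD'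
  obtain ⟨k', v, hv, rfl⟩ := (isPal_decode_iff w).1 hw
  refine lt_of_lt_of_le ?_ (normHamming_le_emd _ _)
  have h1 : r + 1 ≤ hammingDist u v := by
    by_contra h
    exact hu (mem_filter.2 ⟨mem_univ _, k', v, hv, by omega⟩)
  have h2 : ((r + 1 : ℕ) : ℝ) ≤ hammingDist (encode k u) (encode k' v) := by
    exact_mod_cast h1.trans (hammingDist_le_encode k k' u v)
  have hn' : (0 : ℝ) < n := by exact_mod_cast hn
  unfold normHamming
  push_cast at h2 ⊢
  rw [lt_div_iff₀ (by positivity)]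
  linarith

theorem card_fixed_mirror_le {n : ℕ} (k : Fin (n + 1)) :
    (univ.filter fun i => mirror k i = i).card ≤ 2 := by
  rw [← card_image_of_injective _ Fin.val_injective]
  -- Only the centres of the two blocks can be fixed.
  refine (card_le_card (t := {(k.1 - 1) / 2, (n + k.1 - 1) / 2}) fun a ha => ?_).trans
    card_le_two
  obtain ⟨i, hi, rfl⟩ := mem_image.1 ha
  have h := congrArg Fin.val (mem_filter.1 hi).2
  rw [mirror_val] at h
  rw [mem_insert, mem_singleton]
  have := i.2
  split_ifs at h
  · left; omega
  · right; omega

/-- The reflection exchanges `i ≤ mirror k i` with the reverse inequality, and both hold only at the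
at most two fixed points. -/
theorem card_le_mirror {n : ℕ} (k : Fin (n + 1)) :
    2 * (univ.filter fun i => i ≤ mirror k i).card ≤ n + 2 := by
  have h1 : (univ.filter fun i => i ≤ mirror k i).card =
      (univ.filter fun i => mirror k i ≤ i).card := by
    refine card_bij (fun i _ => mirror k i) (fun i hi => ?_)
      (fun i _ i' _ h => (mirror_involutive k).injective h) fun i hi => ?_
    · simpa [mirror_involutive k i] using hi
    · exact ⟨mirror k i, by simpa [mirror_involutive k i] using hi, mirror_involutive k i⟩
  have h2 := card_union_add_card_inter (univ.filter fun i => i ≤ mirror k i)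
    (univ.filter fun i => mirror k i ≤ i)
  rw [← filter_and] at h2
  have h3 : (univ.filter fun i => i ≤ mirror k i ∧ mirror k i ≤ i) =
      univ.filter fun i => mirror k i = i :=
    filter_congr fun i _ => ⟨fun h => le_antisymm h.2 h.1, fun h => ⟨h.ge, h.le⟩⟩
  have h4 := card_le_univ ((univ.filter fun i => i ≤ mirror k i) ∪
    (univ.filter fun i => mirror k i ≤ i))
  rw [Fintype.card_fin] at h4
  rw [h3] at h2
  have := card_fixed_mirror_le k
  omega

theorem card_symmetric_le {n : ℕ} (k : Fin (n + 1)) :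
    (univ.filter fun v : Cube n => ∀ i, v (mirror k i) = v i).card ≤ 2 ^ ((n + 2) / 2) := by
  have h : (univ.filter fun v : Cube n => ∀ i, v (mirror k i) = v i).card ≤
      (univ : Finset ({i // i ≤ mirror k i} → Bool)).card := by
    refine card_le_card_of_injOn (fun v i => v i.1) (fun _ _ => mem_coe.2 (mem_univ _)) ?_
    intro v hv v' hv' h
    have hv := (mem_filter.1 (mem_coe.1 hv)).2
    have hv' := (mem_filter.1 (mem_coe.1 hv')).2
    funext i
    rcases le_total i (mirror k i) with hi | hi
    · exact congrFun h ⟨i, hi⟩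
    · rw [← hv, ← hv']
      exact congrFun h ⟨mirror k i, by rwa [mirror_involutive k i]⟩
  refine h.trans ?_
  rw [card_univ, Fintype.card_fun, Fintype.card_bool, Fintype.card_subtype]
  have := card_le_mirror k
  exact Nat.pow_le_pow_right two_pos (by omega)

/-- The strings with at most `r` ones. -/
def lightStrings (n r : ℕ) : Finset (Cube n) :=
  univ.filter fun e => (univ.filter fun i => e i = true).card ≤ r

/-- A Chernoff-type count: weighting each zero by `16` and each one by `1` gives total weight `17 ^
n`, while a light string weighs at least `16 ^ (n - r)`. -/
theorem card_lightStrings_mul_le (n r : ℕ) :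
    (lightStrings n r).card * 16 ^ n ≤ 17 ^ n * 16 ^ r := by
  have h := Finset.prod_univ_sum (fun _ : Fin n => (univ : Finset Bool))
    fun _ b => if b = true then 1 else 16
  rw [Fintype.piFinset_univ] at h
  have hsum : ∑ e : Cube n, ∏ i, (if e i = true then 1 else 16) = 17 ^ n := by
    rw [← h]
    simp
  rw [← hsum, ← smul_eq_mul, ← sum_const, Finset.sum_mul]
  refine (Finset.sum_le_sum fun e he => ?_).trans
    (Finset.sum_le_sum_of_subset (subset_univ (lightStrings n r)))
  have he := (mem_filter.1 he).2
  rw [Finset.prod_ite, prod_const_one, one_mul, prod_const, ← pow_add]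
  refine Nat.pow_le_pow_right (by norm_num) ?_
  have := card_filter_add_card_filter_not (s := (univ : Finset (Fin n))) (fun i => e i = true)
  rw [card_univ, Fintype.card_fin] at this
  omega

/-- A near-symmetric string is a symmetric one xor a light error; the bound is a union over `k`. -/
theorem card_nearSymmetric_le (n r : ℕ) :
    (nearSymmetric n r).card ≤ (n + 1) * (2 ^ ((n + 2) / 2) * (lightStrings n r).card) := by
  have hsub : nearSymmetric n r ⊆ (univ : Finset (Fin (n + 1))).biUnion fun k =>
      ((univ.filter fun v : Cube n => ∀ i, v (mirror k i) = v i) ×ˢ lightStrings n r).image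
        fun p i => xor (p.1 i) (p.2 i) := by
    intro u hu
    obtain ⟨k, v, hv, hd⟩ := (mem_filter.1 hu).2
    refine mem_biUnion.2 ⟨k, mem_univ _, mem_image.2 ⟨(v, fun i => xor (u i) (v i)),
      mem_product.2 ⟨mem_filter.2 ⟨mem_univ _, hv⟩, mem_filter.2 ⟨mem_univ _, ?_⟩⟩, ?_⟩⟩
    · simpa [hammingDist] using hd
    · funext i
      dsimp only
      cases u i <;> cases v i <;> rfl
  refine (card_le_card hsub).trans ?_
  refine (card_biUnion_le_card_mul _ _ (2 ^ ((n + 2) / 2) * (lightStrings n r).card)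
    fun k _ => card_image_le.trans ?_).trans_eq ?_
  · rw [card_product]
    exact Nat.mul_le_mul_right _ (card_symmetric_le k)
  · simp

theorem eventually_card_nearSymmetric_le :
    ∀ᶠ n : ℕ in Filter.atTop, 6 * (nearSymmetric n (n / 32)).card ≤ 2 ^ n := by
  -- Eighth powers clear the fractional exponents: the factors `2 ^ (n / 2)` and `16 ^ (n / 32)`
  -- become about `2 ^ (4 * n)` and `2 ^ n`, whence `32`, and `32 * 17 ^ 8 < 32 ^ 8`.
  have hlim := tendsto_pow_const_mul_const_pow_of_abs_lt_one 8
    (r := (32 * 17 ^ 8 / 32 ^ 8 : ℝ)) (by rw [abs_of_pos] <;> norm_num)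
  -- One `256` comes from rounding in `(n + 2) / 2`, the other from `(n + 1) ^ 8 ≤ (2 * n) ^ 8`.
  have hev := hlim.eventually (gt_mem_nhds (show (0 : ℝ) < 1 / (256 * 256 * 6 ^ 8) by norm_num))
  filter_upwards [hev, Filter.eventually_ge_atTop 1] with n hn hn1
  set N := (nearSymmetric n (n / 32)).card
  set B := (lightStrings n (n / 32)).card
  have hN : N ≤ (n + 1) * (2 ^ ((n + 2) / 2) * B) := card_nearSymmetric_le n (n / 32)
  have hB : B * 16 ^ n ≤ 17 ^ n * 16 ^ (n / 32) := card_lightStrings_mul_le n (n / 32)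
  have hN8 : (N * 16 ^ n) ^ 8 ≤ (n + 1) ^ 8 * 256 * (32 * 17 ^ 8) ^ n := by
    calc (N * 16 ^ n) ^ 8 ≤ ((n + 1) * 2 ^ ((n + 2) / 2) * (B * 16 ^ n)) ^ 8 := by
          refine Nat.pow_le_pow_left ?_ 8
          calc N * 16 ^ n ≤ (n + 1) * (2 ^ ((n + 2) / 2) * B) * 16 ^ n :=
                Nat.mul_le_mul_right _ hN
            _ = _ := by ring
      _ ≤ ((n + 1) * 2 ^ ((n + 2) / 2) * (17 ^ n * 16 ^ (n / 32))) ^ 8 := by gcongr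
      _ = (n + 1) ^ 8 * 2 ^ (8 * ((n + 2) / 2) + 32 * (n / 32)) * (17 ^ 8) ^ n := by
          rw [show (16 : ℕ) = 2 ^ 4 by norm_num, ← pow_mul, mul_pow, mul_pow, mul_pow, ← pow_mul,
            ← pow_mul, ← pow_mul, ← pow_mul, pow_add]
          ring_nf
      _ ≤ (n + 1) ^ 8 * 2 ^ (8 + 5 * n) * (17 ^ 8) ^ n := by
          exact Nat.mul_le_mul_right _ (Nat.mul_le_mul_left _
            (Nat.pow_le_pow_right two_pos (by omega)))
      _ = _ := by
          rw [pow_add, pow_mul, mul_pow]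
          ring
  have hn1' : (1 : ℝ) ≤ n := by exact_mod_cast hn1
  have hreal : ((6 * N * 16 ^ n : ℕ) : ℝ) ^ 8 ≤ ((2 ^ n * 16 ^ n : ℕ) : ℝ) ^ 8 := by
    have h1 : ((N * 16 ^ n : ℕ) : ℝ) ^ 8 ≤ ((n : ℝ) + 1) ^ 8 * 256 * (32 * 17 ^ 8) ^ n := by
      exact_mod_cast hN8
    calc ((6 * N * 16 ^ n : ℕ) : ℝ) ^ 8 = 6 ^ 8 * ((N * 16 ^ n : ℕ) : ℝ) ^ 8 := by
          push_cast; ring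
      _ ≤ 6 ^ 8 * (((n : ℝ) + 1) ^ 8 * 256 * (32 * 17 ^ 8) ^ n) := by gcongr
      _ ≤ 6 ^ 8 * ((2 * (n : ℝ)) ^ 8 * 256 * (32 * 17 ^ 8) ^ n) := by gcongr; linarith
      _ = 256 * 256 * 6 ^ 8 * ((n : ℝ) ^ 8 * (32 * 17 ^ 8 / 32 ^ 8) ^ n) * (32 ^ 8) ^ n := by
          rw [div_pow]
          field_simp
          ring
      _ ≤ 256 * 256 * 6 ^ 8 * (1 / (256 * 256 * 6 ^ 8)) * (32 ^ 8) ^ n := by gcongr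
      _ = ((2 ^ n * 16 ^ n : ℕ) : ℝ) ^ 8 := by
          rw [← mul_pow]
          push_cast
          rw [← pow_mul, ← pow_mul, mul_comm 8 n]
          norm_num
  have h2 := le_of_pow_le_pow_left₀ (by norm_num) (by positivity) hreal
  have h3 : 6 * N * 16 ^ n ≤ 2 ^ n * 16 ^ n := by exact_mod_cast h2
  exact Nat.le_of_mul_le_mul_right h3 (by positivity)

/-! ### The lower bound for non-adaptive testers -/

/-- The acceptance probability is summed over all `k` and `u`: symmetrized words contribute at least
`2 / 3` each, raw ones at most `1 / 3` unless near-symmetric, and the two sums differ by at most `q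
^ 2 * 2 ^ n`. -/
theorem NonadaptivelyTestable.card_le {n r s q : ℕ} {ε : ℝ} (hr : 2 * n * ε < r + 1) (hn : 0 < n)
    (h : NonadaptivelyTestable (onePal n) ε s q) :
    (n : ℝ) * 2 ^ n ≤ 3 * (n * (nearSymmetric n r).card + q ^ 2 * 2 ^ n) := by
  obtain ⟨A, hyes, hno⟩ := h
  set run : A.Coins → (Fin s → Cube (2 * n)) → Bool := fun ω V => A.output ω fun i j _ => V i j
    with hrun
  let a : A.Coins → Cube (2 * n) → ℝ := fun ω w => if run ω (fun _ => w) = true then 1 else 0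
  have ha0 : ∀ ω w, 0 ≤ a ω w := fun ω w => by simp only [a]; split_ifs <;> norm_num
  have ha1 : ∀ ω w, a ω w ≤ 1 := fun ω w => by simp only [a]; split_ifs <;> norm_num
  have hout : ∀ w, outputProb A.law run (pointDist w) true =
      ∑' ω, (A.law ω).toReal * a ω w := fun w => outputProb_pointDist _ _ _ _
  have hcoin : ∀ ω, ∑ p : Fin n × Cube n,
      a ω (encode p.1.castSucc (symmetrize p.1.castSucc p.2)) ≤
      ∑ p : Fin n × Cube n, a ω (encode p.1.castSucc p.2) + (q : ℝ) ^ 2 * 2 ^ n := by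
    intro ω
    -- All samples of a point mass coincide, so queries to different samples merge into one set and
    -- extra samples do not help.
    let Q : Finset (Fin n) := (univ.biUnion (A.J ω)).image letterPos
    have hQ : Q.card ≤ q := card_image_le.trans (card_biUnion_le.trans (A.card_le ω))
    refine (sum_encode_symmetrize_le (Q := Q) (ha0 ω) (ha1 ω) fun w w' hw => ?_).trans ?_
    · have : (fun (i : Fin s) (j : Fin (2 * n)) (_ : j ∈ A.J ω i) => w j) = fun i j _ => w' j := by
        funext i j hj
        exact hw j (mem_image_of_mem _ (mem_biUnion.2 ⟨i, mem_univ _, hj⟩))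
      simp only [a, run, this]
    · gcongr
  have hsum := sum_tsum_law_le A.law
    (f := fun (p : Fin n × Cube n) ω => a ω (encode p.1.castSucc (symmetrize p.1.castSucc p.2)))
    (g := fun p ω => a ω (encode p.1.castSucc p.2)) (fun _ _ => ha0 _ _) (fun _ _ => ha1 _ _)
    (fun _ _ => ha0 _ _) (fun _ _ => ha1 _ _) hcoin
  simp only [← hout] at hsum
  have hlow : (n : ℝ) * 2 ^ n * (2 / 3) ≤ ∑ p : Fin n × Cube n, outputProb A.law run
      (pointDist (encode p.1.castSucc (symmetrize p.1.castSucc p.2))) true := by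
    have := card_nsmul_le_sum (univ : Finset (Fin n × Cube n)) (fun p => outputProb A.law run
      (pointDist (encode p.1.castSucc (symmetrize p.1.castSucc p.2))) true) (2 / 3)
      fun p _ => hyes _ (encode_symmetrize_mem _ _)
    simpa [mul_assoc] using this
  have hup : ∑ p : Fin n × Cube n, outputProb A.law run (pointDist (encode p.1.castSucc p.2)) true
      ≤ n * 2 ^ n * (1 / 3) + n * (nearSymmetric n r).card := by
    have hle : ∀ p : Fin n × Cube n,
        outputProb A.law run (pointDist (encode p.1.castSucc p.2)) true ≤
          1 / 3 + if p.2 ∈ nearSymmetric n r then 1 else 0 := by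
      intro p
      have h1 := outputProb_true_add_false A.law run (pointDist (encode p.1.castSucc p.2))
      split_ifs with hp
      · have : 0 ≤ outputProb A.law run (pointDist (encode p.1.castSucc p.2)) false := by
          rw [outputProb_pointDist]
          exact tsum_nonneg fun ω => mul_nonneg ENNReal.toReal_nonneg (by split_ifs <;> norm_num)
        linarith
      · have := hno _ (isFar_encode hr hn p.1.castSucc hp)
        linarith
    refine (Finset.sum_le_sum fun p _ => hle p).trans_eq ?_
    rw [Finset.sum_add_distrib, Fintype.sum_prod_type (f := fun p : Fin n × Cube n =>
      if p.2 ∈ nearSymmetric n r then (1 : ℝ) else 0)]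
    simp [mul_assoc]
  linarith

theorem exists_nonadaptive_lower_bound :
    ∃ ε : ℝ, 0 < ε ∧ ε < 1 ∧ ∃ c : ℝ, 0 < c ∧ ∃ n₀ : ℕ, ∀ n : ℕ, n₀ ≤ n → ∀ s q : ℕ,
      NonadaptivelyTestable (onePal n) ε s q → c * Real.sqrt n ≤ q := by
  obtain ⟨n₀, hn₀⟩ := Filter.eventually_atTop.1 eventually_card_nearSymmetric_le
  -- With `ε = 1 / 64` the radius `2 * n * ε` is `n / 32`. Near-symmetric strings cost at most half
  -- of the left side of `card_le`, leaving `n ≤ 6 * q ^ 2 ≤ (3 * q) ^ 2`.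
  refine ⟨1 / 64, by norm_num, by norm_num, 1 / 3, by norm_num, n₀ + 1, fun n hn s q h => ?_⟩
  have hr : 2 * (n : ℝ) * (1 / 64) < (n / 32 : ℕ) + 1 := by
    have : n < 32 * (n / 32 + 1) := by omega
    have : (n : ℝ) < 32 * ((n / 32 : ℕ) + 1) := by exact_mod_cast this
    linarith
  have hmain := h.card_le hr (by omega)
  have hnear : 6 * ((nearSymmetric n (n / 32)).card : ℝ) ≤ 2 ^ n := by
    exact_mod_cast hn₀ n (by omega)
  have hpow : (0 : ℝ) < 2 ^ n := by positivity
  have hq : (n : ℝ) ≤ 6 * q ^ 2 := by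
    have h1 := mul_le_mul_of_nonneg_left hnear (Nat.cast_nonneg (α := ℝ) n)
    have h2 : (n : ℝ) * 2 ^ n ≤ 6 * q ^ 2 * 2 ^ n := by linarith
    exact le_of_mul_le_mul_right h2 hpow
  have : Real.sqrt n ≤ 3 * q := by
    refine Real.sqrt_le_iff.2 ⟨by positivity, ?_⟩
    nlinarith [sq_nonneg (q : ℝ)]
  linarith

end HugeObject

theorem proposition6p5 :
    -- the property is not index-invariant
    (∀ n : ℕ, 2 ≤ n → ¬ HugeObject.IndexInvariant (HugeObject.onePal n)) ∧
    -- `O(log n)` adaptive queries suffice for every `ε`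
    (∀ ε : ℝ, 0 < ε → ε < 1 → ∃ C : ℝ, 0 < C ∧ ∀ n : ℕ, 2 ≤ n →
      ∃ s q : ℕ, (q : ℝ) ≤ C * Real.log n ∧
        HugeObject.AdaptivelyTestable (HugeObject.onePal n) ε s q) ∧
    -- `Ω(√n)` non-adaptive queries are necessary for some `ε`
    (∃ ε : ℝ, 0 < ε ∧ ε < 1 ∧ ∃ c : ℝ, 0 < c ∧ ∃ n₀ : ℕ, ∀ n : ℕ, n₀ ≤ n →
      ∀ s q : ℕ, HugeObject.NonadaptivelyTestable (HugeObject.onePal n) ε s q →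
        c * Real.sqrt n ≤ q) ∧
    -- the gap is never more than exponential, for any property
    (∀ (n : ℕ) (P : HugeObject.DistProperty n) (ε : ℝ), 0 < ε → ε < 1 → ∀ s q : ℕ,
      HugeObject.AdaptivelyTestable P ε s q →
        HugeObject.NonadaptivelyTestable P ε s (2 ^ q - 1)) :=
  ⟨fun _ hn => HugeObject.not_indexInvariant_onePal hn,
    fun _ h0 _ => HugeObject.exists_adaptive_tester h0,
    HugeObject.exists_nonadaptive_lower_bound,
    fun _ _ _ _ _ _ _ h => HugeObject.nonadaptivelyTestable_of_adaptivelyTestable h⟩
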